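/- Let $n\ge 0$ and let $\lambda$ be a partition with $|\lambda|\le n$; write $\ell(\lambda)$ for its number of positive parts, $\lambda'$ for its conjugate ($\lambda'_i=\#\{j:\lambda_j\ge i\}$), and $p^n_m(\lambda)=\lambda'_{n-m+1}+\lambda'_{n-m+2}+\cdots$ for $m\le n$. For $S\subseteq[n]=\{1,\dots,n\}$ let $e_d(S)$ be the elementary symmetric polynomial of degree $d$ in the variables $x_i$, $i\in S$ (with $e_0(S)=1$ and $e_d(S)=0$ for $d>|S|$ or $d<0$). Ideals. Let $I_{n,\lambda,\infty}\subseteq\mathbb{Q}[x_1,\dots,x_n]$ be the ideal generated by all $e_d(S)$ with $S\subseteq[n]$ and $d>|S|-p^n_{|S|}(\lambda)$. For an integer $s\ge 1$ with $s\ge\ell(\lambda)$ let $I_{n,\lambda,s}$ be generated by these polynomials together with $x_1^s,\dots,x_n^s$. Monomials. For $m\ge 0$ let $\rho^{(m)}=(m-1,m-2,\dots,1,0)$. For an integer $s\ge 1$ with $s\ge\ell(\lambda)$, an $(n,\lambda,s)$-staircase is a shuffle of the sequences $\rho^{(\lambda'_1)},\dots,\rho^{(\lambda'_{\lambda_1})}$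 and the constant sequence $(s-1,\dots,s-1)$ of length $n-|\lambda|$; here a shuffle interleaves the sequences, keeping the order of the entries of each. Let $\mathcal C_{n,\lambda,s}$ be the set of $\alpha\in\mathbb{Z}_{\ge0}^n$ that are entrywise at most some $(n,\lambda,s)$-staircase, let $\mathcal C_{n,\lambda,\infty}=\bigcup_{s\ge\max(1,\ell(\lambda))}\mathcal C_{n,\lambda,s}$, and let $\mathcal A_{n,\lambda,s}=\{x^\alpha:\alpha\in\mathcal C_{n,\lambda,s}\}$ for $s$ finite or $s=\infty$. Let $\mathcal A^C_{n,\lambda,\infty}$ be the set of monomials in $x_1,\dots,x_n$ that are not in $\mathcal A_{n,\lambda,\infty}$. Monomial order. Let $<$ be the graded reverse lexicographic order in which $x^a<x^b$ if $\deg x^a<\deg x^b$, or if the degrees are equal and there is an $i$ with $a_j=b_j$ for all $j<i$ and $a_i>b_i$. For $f\neq0$ let $\mathsf{in}_<(f)$ be its largest monomial. The initial ideal $\mathsf{in}_<(I)$ of an ideal $I$ is generated by the $\mathsf{in}_<(f)$ with $0\ne f\in I$. A Gröbner basis of $I$ is a finite subset $G\subseteq I$ such that $\langle\mathsf{in}_<(g):0\ne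 g\in G\rangle=\mathsf{in}_<(I)$. A standard monomial of $I$ is a monomial not in $\mathsf{in}_<(I)$. Lemma. Suppose that $G\subseteq I_{n,\lambda,\infty}$ is a finite set with $$\langle\mathsf{in}_<(F):0\ne F\in G\rangle=\langle\mathcal A^C_{n,\lambda,\infty}\rangle .$$ Then $G$ is a Gröbner basis of $I_{n,\lambda,\infty}$, and $\mathcal A_{n,\lambda,\infty}$ is exactly the set of standard monomials of $I_{n,\lambda,\infty}$. Moreover, for every integer $s\ge 1$ with $\ell(\lambda)\le s<\infty$, the set $G\cup\{x_1^s,\dots,x_n^s\}$ is a Gröbner basis of $I_{n,\lambda,s}$, and $\mathcal A_{n,\lambda,s}$ is exactly the set of standard monomials of $I_{n,\lambda,s}$. -/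

import Mathlib

namespace Griffin

open scoped MonomialOrder

/-! ### The graded reverse lexicographic order -/

/-- Exponent vectors, to be ordered by the graded reverse lexicographic order. -/
structure GRevLex (n : ℕ) where
  /-- The underlying exponent vector. -/
  exps : Fin n →₀ ℕ

namespace GRevLex

/-- Exponent vectors and their ordered copies. -/
def equiv (n : ℕ) : (Fin n →₀ ℕ) ≃ GRevLex n where
  toFun := GRevLex.mk
  invFun := GRevLex.exps
  left_inv _ := rfl
  right_inv _ := rfl

noncomputable instance (n : ℕ) : AddCommMonoid (GRevLex n) := (equiv n).symm.addCommMonoid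

/-- First the total degree, then the reversed lexicographic order, which looks first at the
exponent of the first variable. -/
noncomputable def key {n : ℕ} (a : GRevLex n) : ℕ ×ₗ (Lex (Fin n →₀ ℕ))ᵒᵈ :=
  toLex (a.exps.degree, OrderDual.toDual (toLex a.exps))

theorem key_injective {n : ℕ} : Function.Injective (key (n := n)) := by
  rintro ⟨a⟩ ⟨b⟩ h
  have h2 := congrArg (fun z => ofLex (OrderDual.ofDual (ofLex z).2)) h
  exact congrArg GRevLex.mk h2

noncomputable instance (n : ℕ) : LinearOrder (GRevLex n) := LinearOrder.lift' key key_injective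

theorem lt_iff {n : ℕ} {a b : GRevLex n} : a < b ↔ a.exps.degree < b.exps.degree ∨
    (a.exps.degree = b.exps.degree ∧
      ∃ i, (∀ j < i, a.exps j = b.exps j) ∧ b.exps i < a.exps i) := by
  change key a < key b ↔ _
  rw [Prod.Lex.lt_iff]
  refine or_congr Iff.rfl (and_congr Iff.rfl ?_)
  change toLex b.exps < toLex a.exps ↔ _
  rw [Finsupp.Lex.lt_iff]
  simp only [ofLex_toLex]
  exact exists_congr fun i => and_congr_left' (forall₂_congr fun j _ => eq_comm)

theorem exps_add {n : ℕ} (a b : GRevLex n) : (a + b).exps = a.exps + b.exps := rfl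

instance (n : ℕ) : IsOrderedAddMonoid (GRevLex n) where
  add_le_add_left a b h c := by
    rcases h.eq_or_lt with rfl | h
    · exact le_rfl
    · refine le_of_lt ?_
      rw [lt_iff] at h ⊢
      simpa [exps_add] using h

instance (n : ℕ) : WellFoundedLT (GRevLex n) := by
  have hfin : ∀ a : GRevLex n, (Set.Iio a).Finite := by
    intro a
    have h1 : (Set.Iic (Finsupp.equivFunOnFinite.symm fun _ : Fin n => a.exps.degree)).Finite :=
      Set.finite_Iic _
    refine (h1.image GRevLex.mk).subset ?_
    intro b hb
    refine ⟨b.exps, ?_, rfl⟩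
    intro i
    have h2 : b.exps.degree ≤ a.exps.degree := by
      rcases lt_iff.1 hb with h | h
      · exact h.le
      · exact h.1.le
    exact (Finsupp.le_degree i b.exps).trans h2
  refine ⟨⟨fun a => ?_⟩⟩
  have key : ∀ (N : ℕ) (a : GRevLex n), (Set.Iio a).ncard = N → Acc (· < ·) a := by
    intro N
    induction N using Nat.strong_induction_on with
    | _ N ih =>
      intro a ha
      refine ⟨a, fun b hb => ih _ ?_ b rfl⟩
      rw [← ha]
      exact Set.ncard_lt_ncard (Set.Iio_ssubset_Iio hb) (hfin a)
  exact key _ a rfl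

end GRevLex

/-- The graded reverse lexicographic order on monomials in `n` variables, in the convention in
which the first variable is the smallest one (see `grevlex_lt_iff`). -/
noncomputable def grevlex (n : ℕ) : MonomialOrder (Fin n) where
  syn := GRevLex n
  toSyn := { toEquiv := GRevLex.equiv n, map_add' := fun _ _ => rfl }
  toSyn_monotone a b h := by
    obtain ⟨c, rfl⟩ := exists_add_of_le h
    rcases eq_or_ne c 0 with rfl | hc
    · simp
    · refine le_of_lt (GRevLex.lt_iff.2 (Or.inl ?_))
      change a.degree < (a + c).degree
      have : c.degree ≠ 0 := fun h => hc ((Finsupp.degree_eq_zero_iff c).1 h)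
      rw [map_add]
      omega

theorem grevlex_lt_iff {n : ℕ} {a b : Fin n →₀ ℕ} : a ≺[grevlex n] b ↔
    a.degree < b.degree ∨
      (a.degree = b.degree ∧ ∃ i, (∀ j < i, a j = b j) ∧ b i < a i) :=
  GRevLex.lt_iff

/-! ### Initial ideals, Gröbner bases and standard monomials -/

section Groebner

variable {n : ℕ}

/-- The monomial `x ^ α`. -/
noncomputable def mono (α : Fin n →₀ ℕ) : MvPolynomial (Fin n) ℚ :=
  MvPolynomial.monomial α 1

/-- The leading monomials of the nonzero members of a set of polynomials (the zero polynomial has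
no leading monomial). -/
def leadingMonomials (m : MonomialOrder (Fin n)) (S : Set (MvPolynomial (Fin n) ℚ)) :
    Set (MvPolynomial (Fin n) ℚ) :=
  {p | ∃ f ∈ S, f ≠ 0 ∧ p = mono (m.degree f)}

/-- The initial ideal of an ideal. -/
noncomputable def initialIdeal (m : MonomialOrder (Fin n)) (I : Ideal (MvPolynomial (Fin n) ℚ)) :
    Ideal (MvPolynomial (Fin n) ℚ) :=
  Ideal.span (leadingMonomials m (I : Set (MvPolynomial (Fin n) ℚ)))

/-- A Gröbner basis of `I`: a finite subset of `I` whose leading monomials generate the initial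
ideal. -/
def IsGroebnerBasis (m : MonomialOrder (Fin n)) (G : Set (MvPolynomial (Fin n) ℚ))
    (I : Ideal (MvPolynomial (Fin n) ℚ)) : Prop :=
  G.Finite ∧ G ⊆ (I : Set (MvPolynomial (Fin n) ℚ)) ∧
    Ideal.span (leadingMonomials m G) = initialIdeal m I

/-- The standard monomials of `I`: the monomials outside its initial ideal. -/
def standardMonomials (m : MonomialOrder (Fin n)) (I : Ideal (MvPolynomial (Fin n) ℚ)) :
    Set (MvPolynomial (Fin n) ℚ) :=
  {p | ∃ α : Fin n →₀ ℕ, p = mono α ∧ mono α ∉ initialIdeal m I}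

end Groebner

/-! ### Griffin's ideals -/

/-- `conj lam i` is the part `λ'_i` (with `i ≥ 1`) of the conjugate partition: the number of parts
of `λ` that are at least `i`. -/
def conj {k : ℕ} (lam : Nat.Partition k) (i : ℕ) : ℕ :=
  (lam.parts.filter fun a => i ≤ a).card

/-- `p_m^n(λ) = λ'_{n-m+1} + λ'_{n-m+2} + ⋯` for `m ≤ n`. The sum may stop at `k = |λ|` because no
part of `λ` is larger. -/
def pSum {k : ℕ} (n m : ℕ) (lam : Nat.Partition k) : ℕ :=
  ∑ i ∈ Finset.Icc (n - m + 1) k, conj lam i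

/-- The elementary symmetric polynomial `e_d(S)` in the variables indexed by `S`. -/
noncomputable def elem {n : ℕ} (d : ℕ) (S : Finset (Fin n)) : MvPolynomial (Fin n) ℚ :=
  ∑ t ∈ S.powersetCard d, ∏ i ∈ t, MvPolynomial.X i

/-- The generators `e_d(S)`, `d > |S| - p_{|S|}^n(λ)`, of the ideal `I_{n,λ,∞}`. -/
def idealGenerators {k : ℕ} (n : ℕ) (lam : Nat.Partition k) : Set (MvPolynomial (Fin n) ℚ) :=
  {f | ∃ (S : Finset (Fin n)) (d : ℕ),
    (S.card : ℤ) - (pSum n S.card lam : ℤ) < (d : ℤ) ∧ f = elem d S}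

/-- The set `{x_1 ^ s, …, x_n ^ s}`. -/
def varPowers (n s : ℕ) : Set (MvPolynomial (Fin n) ℚ) :=
  Set.range fun i : Fin n => (MvPolynomial.X i : MvPolynomial (Fin n) ℚ) ^ s

/-- The ideal `I_{n,λ,∞}`. -/
noncomputable def idealInf {k : ℕ} (n : ℕ) (lam : Nat.Partition k) : Ideal (MvPolynomial (Fin n) ℚ) :=
  Ideal.span (idealGenerators n lam)

/-- The ideal `I_{n,λ,s}` for finite `s`. -/
noncomputable def idealFin {k : ℕ} (n : ℕ) (lam : Nat.Partition k) (s : ℕ) :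
    Ideal (MvPolynomial (Fin n) ℚ) :=
  Ideal.span (idealGenerators n lam ∪ varPowers n s)

/-! ### Griffin's monomials -/

/-- The staircase `(m-1, m-2, …, 1, 0)`. -/
def staircase (m : ℕ) : List ℕ := (List.range m).reverse

/-- `γ` is a shuffle of the words in `L`: the positions of `γ` can be coloured by the members of
`L` so that the entries of each colour, read from left to right, form the corresponding word. -/
def IsShuffle {n : ℕ} (γ : Fin n → ℕ) (L : List (List ℕ)) : Prop :=
  ∃ c : Fin n → Fin L.length,
    ∀ j : Fin L.length, ((List.finRange n).filter fun i => c i = j).map γ = L.get j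

/-- The words `ρ^{(λ'_1)}, …, ρ^{(λ'_{λ_1})}` and `(s-1)^{n-|λ|}`. Here `lam.parts.sup` is the
largest part `λ_1` (`0` for the empty partition). -/
def staircaseWords {k : ℕ} (n : ℕ) (lam : Nat.Partition k) (s : ℕ) : List (List ℕ) :=
  ((List.range lam.parts.sup).map fun i => staircase (conj lam (i + 1))) ++
    [List.replicate (n - k) (s - 1)]

/-- The set `C_{n,λ,s}` of weak compositions that lie entrywise below an `(n,λ,s)`-staircase. -/
def compFin {k : ℕ} (n : ℕ) (lam : Nat.Partition k) (s : ℕ) : Set (Fin n →₀ ℕ) :=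
  {α | ∃ γ : Fin n → ℕ, IsShuffle γ (staircaseWords n lam s) ∧ ∀ i, α i ≤ γ i}

/-- The set `C_{n,λ,∞}`, the union of the `C_{n,λ,s}` over all positive `s ≥ ℓ(λ)`. -/
def compInf {k : ℕ} (n : ℕ) (lam : Nat.Partition k) : Set (Fin n →₀ ℕ) :=
  {α | ∃ s : ℕ, 1 ≤ s ∧ lam.parts.card ≤ s ∧ α ∈ compFin n lam s}

/-- The set `A_{n,λ,s}` of monomials, for finite `s`. -/
def monoFin {k : ℕ} (n : ℕ) (lam : Nat.Partition k) (s : ℕ) : Set (MvPolynomial (Fin n) ℚ) :=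
  mono '' compFin n lam s

/-- The set `A_{n,λ,∞}` of monomials. -/
def monoInf {k : ℕ} (n : ℕ) (lam : Nat.Partition k) : Set (MvPolynomial (Fin n) ℚ) :=
  mono '' compInf n lam

/-- The monomials that are not in `A`. -/
def monoCompl {n : ℕ} (A : Set (MvPolynomial (Fin n) ℚ)) : Set (MvPolynomial (Fin n) ℚ) :=
  {p | ∃ α : Fin n →₀ ℕ, p = mono α ∧ mono α ∉ A}

end Griffin

namespace Griffin

/-! For finite `s` the standard monomials of $I_{n,\lambda,s}$ are squeezed between two counts. A
monomial outside $\mathcal A_{n,\lambda,s}$ either lies outside $\mathcal A_{n,\lambda,\infty}$, so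
that a leading monomial of `G` divides it, or has an exponent at least `s`. Hence the standard
exponents lie in $\mathcal C_{n,\lambda,s}$.

The reverse bound comes from a finite set of points: the words in `s` letters in which letter `j`
occurs at least `μ j` times, where `μ` is $\lambda$ padded by zeros (`largeFibers`). Every generator
of $I_{n,\lambda,s}$ is the top-degree form of a polynomial vanishing on these points
(`topLiftable_elem`, `topLiftable_X_pow`). Since the order is graded, the standard monomials
therefore span the functions on the points, so there are at least as many of them as points
(`ncard_le_ncard_standard`). An injection of $\mathcal C_{n,\lambda,s}$ into the set of words
(`exists_injOn_largeFibers`) closes the chain of inequalities.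

The case $s=\infty$ follows from the finite ones, because $I_{n,\lambda,\infty}\subseteq
I_{n,\lambda,s}$. The Gröbner basis claims then follow from the descriptions of the standard
monomials. -/

/-! ### Words below staircases, as a recursion on letters -/

/-- The word `w` lies entrywise below a shuffle of staircases of heights `h 0, h 1, …` and a
constant word with letters `s - 1`. -/
def Below (s : ℕ) : List ℕ → (ℕ → ℕ) → Prop
  -- Every staircase must be used up. The number of constant letters is not recorded: the length of
  -- the word determines it.
  | [], h => ∀ j, h j = 0
  | a :: w, h => (a < s ∧ Below s w h) ∨ ∃ j, a < h j ∧ Below s w (h - Pi.single j 1)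

theorem sub_single_self (h : ℕ → ℕ) (j : ℕ) : (h - Pi.single j 1 : ℕ → ℕ) j = h j - 1 := by
  simp

theorem sub_single_of_ne (h : ℕ → ℕ) {i j : ℕ} (hij : i ≠ j) :
    (h - Pi.single j 1 : ℕ → ℕ) i = h i := by
  simp [hij]

/-- The first letter charged to column `q` is less than `h q ≤ s`, so it can be charged to the
constant word instead. -/
theorem Below.sub_single {s : ℕ} {w : List ℕ} : ∀ {h : ℕ → ℕ}, Below s w h → ∀ {q : ℕ},
    0 < h q → h q ≤ s → Below s w (h - Pi.single q 1) := by
  induction w with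
  | nil => intro h hw q hq _; exact absurd (hw q) hq.ne'
  | cons a w ih =>
    intro h hw q hq hs
    rcases hw with ⟨ha, hw⟩ | ⟨j, ha, hw⟩
    · exact Or.inl ⟨ha, ih hw hq hs⟩
    · by_cases hjq : j = q
      · subst hjq
        exact Or.inl ⟨ha.trans_le hs, hw⟩
      · have e := sub_single_of_ne h (Ne.symm hjq)
        refine Or.inr ⟨j, by rwa [sub_single_of_ne h hjq], ?_⟩
        rw [tsub_right_comm]
        exact ih hw (by rwa [e]) (by rwa [e])

theorem Below.comp_perm {s : ℕ} (e : Equiv.Perm ℕ) {w : List ℕ} : ∀ {h : ℕ → ℕ}, Below s w h →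
    Below s w (h ∘ e) := by
  induction w with
  | nil => intro h hw j; exact hw _
  | cons a w ih =>
    intro h hw
    rcases hw with ⟨ha, hw⟩ | ⟨j, ha, hw⟩
    · exact Or.inl ⟨ha, ih hw⟩
    · refine Or.inr ⟨e.symm j, by simpa using ha, ?_⟩
      have key : h ∘ e - Pi.single (e.symm j) 1 = (h - Pi.single j 1) ∘ e := by
        funext i
        by_cases hi : i = e.symm j
        · subst hi; simp
        · have : e i ≠ j := fun h => hi (by simp [← h])
          simp [hi, this]
      rw [key]
      exact ih hw

/-- Shortening the taller column is the stronger demand. While `h q < h p`, any letter charged to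
`q` may be charged to `p`; once the heights agree, the two situations differ by a transposition of
columns. -/
theorem Below.exchange {s : ℕ} {w : List ℕ} : ∀ {h : ℕ → ℕ} {p q : ℕ}, p ≠ q →
    Below s w (h - Pi.single p 1) → 0 < h q → h q ≤ h p → Below s w (h - Pi.single q 1) := by
  induction w with
  | nil =>
    intro h p q hpq hw hq _
    have := hw q
    rw [sub_single_of_ne h hpq.symm] at this
    exact absurd this hq.ne'
  | cons a w ih =>
    intro h p q hpq hw hq hle
    rcases hle.eq_or_lt with heq | hlt
    · have key : h - Pi.single q 1 = (h - Pi.single p 1) ∘ Equiv.swap p q := by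
        funext i
        by_cases hip : i = p
        · subst hip; simp [hpq, hpq.symm, heq]
        · by_cases hiq : i = q
          · subst hiq; simp [heq]
          · simp [hip, hiq, Equiv.swap_apply_of_ne_of_ne]
      rw [key]
      exact hw.comp_perm _
    · rcases hw with ⟨ha, hw⟩ | ⟨j, ha, hw⟩
      · exact Or.inl ⟨ha, ih hpq hw hq hle⟩
      · by_cases hjp : j = p
        · subst hjp
          rw [sub_single_self] at ha
          refine Or.inr ⟨j, by rw [sub_single_of_ne h hpq]; omega, ?_⟩
          rw [tsub_right_comm]
          have e := sub_single_of_ne h hpq.symm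
          exact ih hpq hw (by rwa [e]) (by rw [e, sub_single_self]; omega)
        · by_cases hjq : j = q
          · subst hjq
            rw [sub_single_of_ne h hjp] at ha
            -- The letter moves from the shorter column to `p`; either way both columns have now
            -- lost one.
            refine Or.inr ⟨p, by rw [sub_single_of_ne h hpq]; omega, ?_⟩
            rwa [tsub_right_comm]
          · rw [sub_single_of_ne h hjp] at ha
            refine Or.inr ⟨j, by rwa [sub_single_of_ne h hjq], ?_⟩
            rw [tsub_right_comm] at hw ⊢
            exact ih hpq hw (by rwa [sub_single_of_ne h (Ne.symm hjq)])
              (by rwa [sub_single_of_ne h (Ne.symm hjq), sub_single_of_ne h (Ne.symm hjp)])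

/-! ### Row lengths and column heights -/

/-- The height of the `j`-th column of a diagram with row lengths `μ`. -/
def colHeight {s : ℕ} (μ : Fin s → ℕ) (j : ℕ) : ℕ :=
  (Finset.univ.filter fun i => j < μ i).card

theorem colHeight_le {s : ℕ} (μ : Fin s → ℕ) (j : ℕ) : colHeight μ j ≤ s :=
  (Finset.card_le_univ _).trans (Fintype.card_fin s).le

theorem colHeight_antitone {s : ℕ} (μ : Fin s → ℕ) : Antitone (colHeight μ) := fun _ _ h =>
  Finset.card_le_card fun _ hi => by
    simp only [Finset.mem_filter, Finset.mem_univ, true_and] at hi ⊢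
    omega

theorem colHeight_sub_single {s : ℕ} (μ : Fin s → ℕ) {r : Fin s} {v : ℕ} (hv : μ r = v + 1) :
    colHeight (μ - Pi.single r 1) = colHeight μ - Pi.single v 1 := by
  funext j
  by_cases hj : j = v
  · subst hj
    rw [sub_single_self, colHeight, colHeight, ← Finset.card_erase_of_mem (a := r) (by simp [hv])]
    congr 1
    ext i
    by_cases hi : i = r
    · subst hi; simp [hv]
    · simp [hi]
  · rw [sub_single_of_ne _ hj, colHeight, colHeight]
    congr 1
    ext i
    by_cases hi : i = r
    · subst hi; simp [hv]; omega
    · simp [hi]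

/-- With `colHeight_le_of_le`: when `σ` sorts the rows by decreasing length, the columns taller than
`a` are exactly those with index below `μ (σ a)`. -/
theorem lt_colHeight {s : ℕ} {μ : Fin s → ℕ} {σ : Equiv.Perm (Fin s)} (hσ : Antitone (μ ∘ σ))
    {a : Fin s} {v : ℕ} (hv : v < μ (σ a)) : (a : ℕ) < colHeight μ v := by
  have h : (Finset.Iic a).map σ.toEmbedding ⊆ Finset.univ.filter fun i => v < μ i := by
    intro i hi
    simp only [Finset.mem_map, Finset.mem_Iic] at hi
    obtain ⟨b, hb, rfl⟩ := hi
    simpa using hv.trans_le (hσ hb)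
  have := Finset.card_le_card h
  rw [Finset.card_map, Fin.card_Iic] at this
  exact this

theorem colHeight_le_of_le {s : ℕ} {μ : Fin s → ℕ} {σ : Equiv.Perm (Fin s)}
    (hσ : Antitone (μ ∘ σ)) {a : Fin s} {v : ℕ} (hv : μ (σ a) ≤ v) : colHeight μ v ≤ a := by
  have h : (Finset.univ.filter fun i => v < μ i) ⊆ (Finset.Iio a).map σ.toEmbedding := by
    intro i hi
    simp only [Finset.mem_filter, Finset.mem_univ, true_and] at hi
    simp only [Finset.mem_map, Finset.mem_Iio]
    refine ⟨σ.symm i, ?_, by simp⟩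
    by_contra hlt
    have : μ (σ (σ.symm i)) ≤ μ (σ a) := hσ (not_lt.1 hlt)
    rw [Equiv.apply_symm_apply] at this
    omega
  have := Finset.card_le_card h
  rwa [Finset.card_map, Fin.card_Iio] at this

theorem exists_antitone_comp_perm {s : ℕ} (μ : Fin s → ℕ) :
    ∃ σ : Equiv.Perm (Fin s), Antitone (μ ∘ σ) :=
  ⟨Tuple.sort (OrderDual.toDual ∘ μ), fun _ _ h =>
    Tuple.monotone_sort (OrderDual.toDual ∘ μ) h⟩

theorem Below.lt_of_cons {s a : ℕ} {w : List ℕ} {μ : Fin s → ℕ}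
    (h : Below s (a :: w) (colHeight μ)) : a < s := by
  rcases h with h | ⟨j, hj, _⟩
  · exact h.1
  · exact hj.trans_le (colHeight_le μ j)

/-- Removing the last box of row `σ a` shortens the last, hence a shortest, column taller than `a`.
Whichever word the letter `a` was charged to, `Below.sub_single` or `Below.exchange` transfers the
charge to that column. -/
theorem Below.tail {s : ℕ} {w : List ℕ} {μ : Fin s → ℕ} {σ : Equiv.Perm (Fin s)}
    (hσ : Antitone (μ ∘ σ)) {a : Fin s} (h : Below s ((a : ℕ) :: w) (colHeight μ)) :
    Below s w (colHeight (μ - Pi.single (σ a) 1)) := by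
  rcases hv : μ (σ a) with _ | v
  · have e : μ - Pi.single (σ a) 1 = μ := by
      funext i
      by_cases hi : i = σ a
      · subst hi; simp [hv]
      · simp [hi]
    rw [e]
    rcases h with h | ⟨j, hj, _⟩
    · exact h.2
    · exact absurd (colHeight_le_of_le hσ (v := j) (by omega)) (not_le.2 hj)
  · rw [colHeight_sub_single μ hv]
    have hpos : (a : ℕ) < colHeight μ v := lt_colHeight hσ (by omega)
    rcases h with h | ⟨j, hj, hw⟩
    · exact h.2.sub_single (by omega) (colHeight_le _ _)
    · by_cases hjv : j = v
      · subst hjv; exact hw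
      · have hjle : j ≤ v := by
          by_contra hlt
          exact absurd (colHeight_le_of_le hσ (v := j) (by omega)) (not_le.2 hj)
        exact hw.exchange hjv (by omega) (colHeight_antitone μ hjle)

/-! ### The injection into words with large fibres -/

/-- The functions whose fibre over each `j` has at least `μ j` elements. -/
def largeFibers (n : ℕ) {s : ℕ} (μ : Fin s → ℕ) : Set (Fin n → Fin s) :=
  {f | ∀ j, μ j ≤ (Finset.univ.filter fun i => f i = j).card}

theorem cons_mem_largeFibers {n s : ℕ} {μ : Fin s → ℕ} {r : Fin s} {f : Fin n → Fin s}
    (hf : f ∈ largeFibers n (μ - Pi.single r 1)) :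
    (Fin.cons r f : Fin (n + 1) → Fin s) ∈ largeFibers (n + 1) μ := by
  intro j
  have h := hf j
  rw [Fin.card_filter_univ_succ]
  simp only [Fin.cons_zero, Fin.cons_succ]
  by_cases hj : j = r
  · subst hj
    simp only [Pi.sub_apply, Pi.single_eq_same] at h
    rw [if_pos rfl]
    omega
  · rw [if_neg (Ne.symm hj)]
    simpa [hj] using h

/-- The first letter `a` is sent to the row `σ a`, and the remaining letters are treated with one
box removed from that row. As `σ` depends only on `μ`, the row determines `a`, which gives
injectivity. -/
theorem exists_injOn_largeFibers {s : ℕ} [NeZero s] (n : ℕ) : ∀ μ : Fin s → ℕ,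
    ∃ Φ : (Fin n → ℕ) → (Fin n → Fin s),
      Set.InjOn Φ {α | Below s (List.ofFn α) (colHeight μ)} ∧
      Set.MapsTo Φ {α | Below s (List.ofFn α) (colHeight μ)} (largeFibers n μ) := by
  induction n with
  | zero =>
    intro μ
    refine ⟨fun _ i => i.elim0, fun _ _ _ _ _ => Subsingleton.elim _ _, ?_⟩
    intro α hα j
    rw [Set.mem_ofPred_eq, List.ofFn_zero] at hα
    by_contra hj
    have h1 : j ∈ Finset.univ.filter fun i => 0 < μ i := by simp at hj ⊢; omega
    -- Column `0` counts the nonempty rows.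
    have h0 := hα 0
    rw [colHeight, Finset.card_eq_zero] at h0
    simp [h0] at h1
  | succ n ih =>
    intro μ
    obtain ⟨σ, hσ⟩ := exists_antitone_comp_perm μ
    choose Φ hinj hmaps using fun r => ih (μ - Pi.single r 1)
    have key : ∀ α : Fin (n + 1) → ℕ, Below s (List.ofFn α) (colHeight μ) →
        α 0 < s ∧ Below s (List.ofFn (Fin.tail α))
          (colHeight (μ - Pi.single (σ (Fin.ofNat s (α 0))) 1)) := by
      intro α hα
      rw [List.ofFn_succ] at hα
      have hlt := hα.lt_of_cons
      refine ⟨hlt, Below.tail hσ ?_⟩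
      rw [Fin.val_ofNat, Nat.mod_eq_of_lt hlt]
      exact hα
    -- `Fin.ofNat` reduces modulo `s`, which is harmless: `α 0 < s` on the set concerned.
    refine ⟨fun α => Fin.cons (σ (Fin.ofNat s (α 0))) (Φ (σ (Fin.ofNat s (α 0))) (Fin.tail α)),
      ?_, fun α hα => cons_mem_largeFibers (hmaps _ (key α hα).2)⟩
    intro α hα β hβ hαβ
    obtain ⟨hα0, hα1⟩ := key α hα
    obtain ⟨hβ0, hβ1⟩ := key β hβ
    obtain ⟨h0, h1⟩ := Fin.cons_injective2 hαβ
    have h0' := congrArg Fin.val (σ.injective h0)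
    rw [Fin.val_ofNat, Fin.val_ofNat, Nat.mod_eq_of_lt hα0, Nat.mod_eq_of_lt hβ0] at h0'
    rw [h0'] at h1 hα1
    rw [← Fin.cons_self_tail α, ← Fin.cons_self_tail β, h0', hinj _ hα1 hβ1 h1]

/-! ### From shuffles to the recursion -/

theorem staircase_succ (m : ℕ) : staircase (m + 1) = m :: staircase m := by
  simp [staircase, List.range_succ]

theorem staircase_eq_cons {m a : ℕ} {w : List ℕ} (h : a :: w = staircase m) :
    a < m ∧ w = staircase (m - 1) := by
  cases m with
  | zero => simp [staircase] at h
  | succ m =>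
    rw [staircase_succ, List.cons.injEq] at h
    exact ⟨by omega, h.2⟩

/-- The colour `none` marks the constant word. Reading the first letter of a staircase leaves the
staircase that is one shorter. -/
theorem below_of_coloring {s n : ℕ} : ∀ {h : ℕ → ℕ} {α γ : Fin n → ℕ} {c : Fin n → Option ℕ},
    (∀ j, ((List.finRange n).filter fun i => c i = some j).map γ = staircase (h j)) →
    (∀ i, c i = none → γ i < s) → (∀ i, α i ≤ γ i) → Below s (List.ofFn α) h := by
  induction n with
  | zero =>
    intro h α γ c hc _ _ j
    have := congrArg List.length (hc j)
    simpa [staircase] using this.symm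
  | succ n ih =>
    intro h α γ c hc hs hle
    have hc' : ∀ j, (if c 0 = some j then [γ 0] else []) ++
        ((List.finRange n).filter fun i => c i.succ = some j).map (γ ∘ Fin.succ) =
          staircase (h j) := by
      intro j
      rw [← hc j, List.finRange_succ, List.filter_cons, List.filter_map]
      by_cases h0 : c 0 = some j <;> simp [h0, Function.comp_def]
    rw [List.ofFn_succ]
    rcases h0 : c 0 with _ | j
    · refine Or.inl ⟨(hle 0).trans_lt (hs 0 h0), ih (γ := γ ∘ Fin.succ) (c := c ∘ Fin.succ)
        (fun j => ?_) (fun i hi => hs _ hi) fun i => hle _⟩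
      have := hc' j
      rw [h0] at this
      simpa using this
    · have hj := hc' j
      rw [if_pos h0, List.singleton_append] at hj
      obtain ⟨h1, h2⟩ := staircase_eq_cons hj
      refine Or.inr ⟨j, (hle 0).trans_lt h1, ih (γ := γ ∘ Fin.succ) (c := c ∘ Fin.succ)
        (fun i => ?_) (fun i hi => hs _ hi) fun i => hle _⟩
      by_cases hij : i = j
      · subst hij
        rw [sub_single_self]
        exact h2
      · have := hc' i
        rw [h0, if_neg (by simpa using Ne.symm hij), List.nil_append] at this
        rw [sub_single_of_ne _ hij]
        exact this

theorem conj_eq_zero {k : ℕ} (lam : Nat.Partition k) {j : ℕ} (hj : lam.parts.sup ≤ j) :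
    conj lam (j + 1) = 0 := by
  rw [conj, Multiset.card_eq_zero, Multiset.filter_eq_nil]
  intro a ha h
  have := Multiset.le_sup ha
  omega

theorem conj_le_card {k : ℕ} (lam : Nat.Partition k) (j : ℕ) : conj lam j ≤ lam.parts.card :=
  Multiset.card_le_card (Multiset.filter_le _ _)

theorem length_staircaseWords {k : ℕ} (n : ℕ) (lam : Nat.Partition k) (s : ℕ) :
    (staircaseWords n lam s).length = lam.parts.sup + 1 := by
  simp [staircaseWords]

theorem staircaseWords_get_of_lt {k : ℕ} (n : ℕ) (lam : Nat.Partition k) (s : ℕ)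
    {j : Fin (staircaseWords n lam s).length} (hj : (j : ℕ) < lam.parts.sup) :
    (staircaseWords n lam s).get j = staircase (conj lam (j + 1)) := by
  rw [List.get_eq_getElem]
  simp [staircaseWords, List.getElem_append_left, hj]

theorem staircaseWords_get_of_ge {k : ℕ} (n : ℕ) (lam : Nat.Partition k) (s : ℕ)
    {j : Fin (staircaseWords n lam s).length} (hj : lam.parts.sup ≤ (j : ℕ)) :
    (staircaseWords n lam s).get j = List.replicate (n - k) (s - 1) := by
  rw [List.get_eq_getElem]
  simp [staircaseWords, List.getElem_append_right, hj]

/-- Entries of a shuffle belong to the words of their colours. -/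
theorem apply_mem_get {n : ℕ} {γ : Fin n → ℕ} {L : List (List ℕ)} {c : Fin n → Fin L.length}
    (hc : ∀ j, ((List.finRange n).filter fun i => c i = j).map γ = L.get j) (i : Fin n) :
    γ i ∈ L.get (c i) := by
  rw [← hc, List.mem_map]
  exact ⟨i, by simp, rfl⟩

theorem below_of_mem_compFin {n k s : ℕ} {lam : Nat.Partition k} (hs : 1 ≤ s)
    {α : Fin n →₀ ℕ} (hα : α ∈ compFin n lam s) :
    Below s (List.ofFn α) fun j => conj lam (j + 1) := by
  obtain ⟨γ, ⟨c, hc⟩, hle⟩ := hα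
  refine below_of_coloring (γ := γ)
    (c := fun i => if (c i : ℕ) < lam.parts.sup then some (c i : ℕ) else none) ?_ ?_ hle
  · intro j
    by_cases hj : j < lam.parts.sup
    · have hlen : j < (staircaseWords n lam s).length := by
        rw [length_staircaseWords]; omega
      have h := hc ⟨j, hlen⟩
      rw [staircaseWords_get_of_lt n lam s (by exact hj)] at h
      rw [← h]
      congr 2
      funext i
      by_cases hi : (c i : ℕ) < lam.parts.sup
      · simp [hi, Fin.ext_iff]
      · have : (c i : ℕ) ≠ j := by omega
        simp [hi, Fin.ext_iff, this]
    · rw [conj_eq_zero lam (not_lt.1 hj), List.filter_eq_nil_iff.2]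
      · rfl
      · intro i _
        by_cases hi : (c i : ℕ) < lam.parts.sup
        · have : (c i : ℕ) ≠ j := by omega
          simp [hi, this]
        · simp [hi]
  · intro i hi
    have hge : lam.parts.sup ≤ (c i : ℕ) := by
      by_contra h
      simp [not_le.1 h] at hi
    have := apply_mem_get hc i
    rw [staircaseWords_get_of_ge n lam s hge] at this
    have := List.eq_of_mem_replicate this
    omega

theorem apply_lt_of_mem_compFin {n k s : ℕ} {lam : Nat.Partition k} (hs : 1 ≤ s)
    (hl : lam.parts.card ≤ s) {α : Fin n →₀ ℕ} (hα : α ∈ compFin n lam s) (i : Fin n) :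
    α i < s := by
  obtain ⟨γ, ⟨c, hc⟩, hle⟩ := hα
  refine (hle i).trans_lt ?_
  have h := apply_mem_get hc i
  by_cases hi : (c i : ℕ) < lam.parts.sup
  · rw [staircaseWords_get_of_lt n lam s hi] at h
    simp only [staircase, List.mem_reverse, List.mem_range] at h
    exact h.trans_le ((conj_le_card lam _).trans hl)
  · rw [staircaseWords_get_of_ge n lam s (not_lt.1 hi)] at h
    have := List.eq_of_mem_replicate h
    omega

/-- The two families of words differ only in their constant letters, so the colouring is kept and `t
- 1` is replaced by `s - 1`, which still bounds `α`. -/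
theorem mem_compFin_of_forall_lt {n k s t : ℕ} {lam : Nat.Partition k} {α : Fin n →₀ ℕ}
    (hα : α ∈ compFin n lam t) (hlt : ∀ i, α i < s) : α ∈ compFin n lam s := by
  obtain ⟨γ, ⟨c, hc⟩, hle⟩ := hα
  have hlen : (staircaseWords n lam t).length = (staircaseWords n lam s).length := by
    rw [length_staircaseWords, length_staircaseWords]
  refine ⟨fun i => if (c i : ℕ) < lam.parts.sup then γ i else s - 1,
    ⟨fun i => Fin.cast hlen (c i), fun j => ?_⟩, fun i => ?_⟩
  · have hcj := hc (Fin.cast hlen.symm j)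
    have hfil : ((List.finRange n).filter fun i => Fin.cast hlen (c i) = j) =
        (List.finRange n).filter fun i => c i = Fin.cast hlen.symm j := by
      congr 1
      funext i
      simp [Fin.ext_iff]
    rw [hfil]
    by_cases hj : (j : ℕ) < lam.parts.sup
    · rw [staircaseWords_get_of_lt n lam s hj]
      rw [staircaseWords_get_of_lt n lam t (by exact hj)] at hcj
      rw [show (j : ℕ) = (Fin.cast hlen.symm j : ℕ) from rfl, ← hcj]
      refine List.map_congr_left fun i hi => ?_
      have : c i = Fin.cast hlen.symm j := by simpa using hi
      simp [this, hj]
    · rw [staircaseWords_get_of_ge n lam s (not_lt.1 hj)]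
      rw [staircaseWords_get_of_ge n lam t (by exact not_lt.1 hj)] at hcj
      have hl := congrArg List.length hcj
      rw [List.length_map, List.length_replicate] at hl
      rw [List.eq_replicate_iff]
      refine ⟨by rw [List.length_map, hl], fun b hb => ?_⟩
      obtain ⟨i, hi, rfl⟩ := List.mem_map.1 hb
      have : c i = Fin.cast hlen.symm j := by simpa using hi
      simp [this, hj]
  · have := hle i
    have := hlt i
    dsimp only
    split_ifs <;> omega

/-- The parts of a partition, padded by zeros, as a function on `Fin s`. -/
theorem exists_rows {k s : ℕ} (lam : Nat.Partition k) (hl : lam.parts.card ≤ s) :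
    ∃ μ : Fin s → ℕ, Finset.univ.val.map μ =
      lam.parts + Multiset.replicate (s - lam.parts.card) 0 := by
  set t := lam.parts + Multiset.replicate (s - lam.parts.card) 0 with ht
  have hlen : t.toList.length = s := by
    rw [Multiset.length_toList, ht, Multiset.card_add, Multiset.card_replicate]
    omega
  refine ⟨fun i => t.toList.get (Fin.cast hlen.symm i), ?_⟩
  conv_rhs => rw [← Multiset.coe_toList t]
  rw [Fin.univ_val_map]
  congr 1
  refine List.ext_getElem (by simp [hlen]) fun i h1 h2 => by simp

theorem colHeight_eq_conj {k s : ℕ} {lam : Nat.Partition k} {μ : Fin s → ℕ}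
    (hμ : Finset.univ.val.map μ = lam.parts + Multiset.replicate (s - lam.parts.card) 0) :
    colHeight μ = fun j => conj lam (j + 1) := by
  funext j
  have h : (Multiset.filter (j < ·) (Finset.univ.val.map μ)).card = colHeight μ j := by
    rw [Multiset.filter_map, Multiset.card_map]
    rfl
  rw [← h, hμ, Multiset.filter_add, Multiset.card_add, conj]
  simp [Multiset.filter_eq_nil, Multiset.mem_replicate]

theorem finite_compFin {n k s : ℕ} {lam : Nat.Partition k} (hs : 1 ≤ s)
    (hl : lam.parts.card ≤ s) : (compFin n lam s).Finite :=
  (Set.finite_Iic (Finsupp.equivFunOnFinite.symm fun _ : Fin n => s)).subset fun _ hα i =>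
    (apply_lt_of_mem_compFin hs hl hα i).le

theorem ncard_compFin_le {n k s : ℕ} {lam : Nat.Partition k} (hs : 1 ≤ s) {μ : Fin s → ℕ}
    (hμ : Finset.univ.val.map μ = lam.parts + Multiset.replicate (s - lam.parts.card) 0) :
    (compFin n lam s).ncard ≤ (largeFibers n μ).ncard := by
  have : NeZero s := ⟨by omega⟩
  obtain ⟨Φ, hinj, hmaps⟩ := exists_injOn_largeFibers n μ
  rw [colHeight_eq_conj hμ] at hinj hmaps
  refine Set.ncard_le_ncard_of_injOn (fun α => Φ α)
    (fun α hα => hmaps (below_of_mem_compFin hs hα)) (fun α hα β hβ h => ?_) (Set.toFinite _)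
  exact DFunLike.coe_injective
    (hinj (below_of_mem_compFin hs hα) (below_of_mem_compFin hs hβ) h)

/-! ### Lifting top-degree forms into an ideal -/

open MvPolynomial
open scoped MonomialOrder

/-- Every homogeneous component of `f` is the leading form, up to terms of smaller degree, of a
member of `J`. -/
def TopLiftable {n : ℕ} (J : Ideal (MvPolynomial (Fin n) ℚ)) (f : MvPolynomial (Fin n) ℚ) : Prop :=
  ∀ N : ℕ, ∃ g ∈ J, ∀ m : Fin n →₀ ℕ, N ≤ m.degree →
    coeff m g = if m.degree = N then coeff m f else 0

section TopLiftable

variable {n : ℕ} {J : Ideal (MvPolynomial (Fin n) ℚ)}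

theorem topLiftable_zero : TopLiftable J 0 := fun _ => ⟨0, J.zero_mem, fun m _ => by simp⟩

/-- Additivity is the reason for treating each degree `N` separately: a condition on the top form
alone would not survive cancellation. -/
theorem TopLiftable.add {f f' : MvPolynomial (Fin n) ℚ} (hf : TopLiftable J f)
    (hf' : TopLiftable J f') : TopLiftable J (f + f') := fun N => by
  obtain ⟨g, hg, h⟩ := hf N
  obtain ⟨g', hg', h'⟩ := hf' N
  refine ⟨g + g', J.add_mem hg hg', fun m hm => ?_⟩
  rw [coeff_add, h m hm, h' m hm, coeff_add]
  split_ifs <;> simp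

theorem TopLiftable.C_mul {f : MvPolynomial (Fin n) ℚ} (hf : TopLiftable J f) (a : ℚ) :
    TopLiftable J (C a * f) := fun N => by
  obtain ⟨g, hg, h⟩ := hf N
  refine ⟨C a * g, J.mul_mem_left _ hg, fun m hm => ?_⟩
  rw [coeff_C_mul, h m hm, coeff_C_mul]
  split_ifs <;> simp

theorem TopLiftable.mul_X {f : MvPolynomial (Fin n) ℚ} (hf : TopLiftable J f) (i : Fin n) :
    TopLiftable J (f * X i) := fun N => by
  cases N with
  | zero =>
    -- A multiple of a variable has no constant term.
    refine ⟨0, J.zero_mem, fun m _ => ?_⟩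
    split_ifs with h
    · rw [Finsupp.degree_eq_zero_iff] at h
      simp [h, coeff_mul_X']
    · simp
  | succ N =>
    obtain ⟨g, hg, h⟩ := hf N
    refine ⟨g * X i, J.mul_mem_right _ hg, fun m hm => ?_⟩
    rw [coeff_mul_X', coeff_mul_X']
    by_cases hi : i ∈ m.support
    · rw [if_pos hi, if_pos hi]
      obtain ⟨m', rfl⟩ : ∃ m', m = m' + Finsupp.single i 1 :=
        ⟨m - Finsupp.single i 1, (tsub_add_cancel_of_le (by
          rw [Finsupp.single_le_iff]
          exact Nat.one_le_iff_ne_zero.2 (Finsupp.mem_support_iff.1 hi))).symm⟩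
      rw [map_add, Finsupp.degree_single] at hm
      rw [add_tsub_cancel_right, h m' (by omega), map_add, Finsupp.degree_single]
      simp
    · simp [hi]

theorem TopLiftable.mul {f : MvPolynomial (Fin n) ℚ} (hf : TopLiftable J f)
    (p : MvPolynomial (Fin n) ℚ) : TopLiftable J (p * f) := by
  induction p using MvPolynomial.induction_on with
  | C a => exact hf.C_mul a
  | add p q hp hq => rw [add_mul]; exact hp.add hq
  | mul_X p i hp =>
    rw [mul_right_comm]
    exact hp.mul_X i

theorem topLiftable_of_mem_span {A : Set (MvPolynomial (Fin n) ℚ)}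
    (hA : ∀ f ∈ A, TopLiftable J f) {f : MvPolynomial (Fin n) ℚ} (hf : f ∈ Ideal.span A) :
    TopLiftable J f := by
  induction hf using Submodule.span_induction with
  | mem f hf => exact hA f hf
  | zero => exact topLiftable_zero
  | add f g _ _ hf hg => exact hf.add hg
  | smul p f _ hf => exact hf.mul p

/-- The sum has top form `H d`; its other terms have lower degree. -/
theorem topLiftable_of_sum_mem {d : ℕ} {b : ℕ → ℚ} {H : ℕ → MvPolynomial (Fin n) ℚ}
    (hH : ∀ i, (H i).IsHomogeneous i) (hb : b d = 1)
    (hJ : ∑ i ∈ Finset.range (d + 1), C (b i) * H i ∈ J) : TopLiftable J (H d) := fun N => by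
  by_cases hN : N = d
  · subst hN
    refine ⟨_, hJ, fun m hm => ?_⟩
    rw [coeff_sum, Finset.sum_range_succ, Finset.sum_eq_zero, zero_add, coeff_C_mul, hb, one_mul]
    · split_ifs with h
      · rfl
      · exact (hH N).coeff_eq_zero h
    · intro i hi
      rw [Finset.mem_range] at hi
      rw [coeff_C_mul, (hH i).coeff_eq_zero (by omega), mul_zero]
  · refine ⟨0, J.zero_mem, fun m _ => ?_⟩
    split_ifs with h
    · rw [(hH d).coeff_eq_zero (by omega), coeff_zero]
    · simp

/-- A nonzero liftable polynomial has the same leading monomial as some member of `J`. -/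
theorem TopLiftable.exists_mem_le {f : MvPolynomial (Fin n) ℚ} (hf : TopLiftable J f)
    (hf0 : f ≠ 0) : ∃ g ∈ J, coeff ((grevlex n).degree f) g ≠ 0 ∧
      ∀ m, coeff m g ≠ 0 → m ≼[grevlex n] (grevlex n).degree f := by
  obtain ⟨g, hg, h⟩ := hf ((grevlex n).degree f).degree
  refine ⟨g, hg, ?_, fun m hm => ?_⟩
  · rw [h _ le_rfl, if_pos rfl]
    exact (grevlex n).coeff_degree_ne_zero_iff.2 hf0
  · by_cases hle : ((grevlex n).degree f).degree ≤ m.degree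
    · rw [h m hle] at hm
      split_ifs at hm with hd
      · exact (grevlex n).le_degree (mem_support_iff.2 hm)
      · exact absurd rfl hm
    -- Here the order must be graded: the uncontrolled terms of `g` have smaller degree.
    · exact le_of_lt (grevlex_lt_iff.2 (Or.inl (not_le.1 hle)))

end TopLiftable

/-! ### Monomials in initial ideals -/

section Initial

variable {n : ℕ}

theorem mono_mem_span_iff {A : Set (Fin n →₀ ℕ)} {α : Fin n →₀ ℕ} :
    mono α ∈ Ideal.span (mono '' A) ↔ ∃ β ∈ A, β ≤ α := by
  have : mono '' A = (fun s => monomial s (1 : ℚ)) '' A := rfl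
  rw [this, mem_ideal_span_monomial_image]
  simp [mono, support_monomial]

theorem leadingMonomials_eq_image (m : MonomialOrder (Fin n))
    (A : Set (MvPolynomial (Fin n) ℚ)) :
    leadingMonomials m A = mono '' (m.degree '' (A \ {0})) := by
  ext p
  simp only [leadingMonomials, Set.mem_image, Set.mem_sdiff, Set.mem_singleton_iff,
    exists_exists_and_eq_and, Set.mem_ofPred_eq]
  constructor
  · rintro ⟨f, hf, h0, rfl⟩; exact ⟨f, ⟨hf, h0⟩, rfl⟩
  · rintro ⟨f, ⟨hf, h0⟩, rfl⟩; exact ⟨f, hf, h0, rfl⟩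

theorem mono_mem_span_leadingMonomials {m : MonomialOrder (Fin n)}
    {A : Set (MvPolynomial (Fin n) ℚ)} {α : Fin n →₀ ℕ} :
    mono α ∈ Ideal.span (leadingMonomials m A) ↔ ∃ f ∈ A, f ≠ 0 ∧ m.degree f ≤ α := by
  rw [leadingMonomials_eq_image, mono_mem_span_iff]
  constructor
  · rintro ⟨_, ⟨f, ⟨hf, h0⟩, rfl⟩, h⟩; exact ⟨f, hf, h0, h⟩
  · rintro ⟨f, hf, h0, h⟩; exact ⟨_, ⟨f, ⟨hf, h0⟩, rfl⟩, h⟩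

theorem leadingMonomials_mono {m : MonomialOrder (Fin n)} {A B : Set (MvPolynomial (Fin n) ℚ)}
    (h : A ⊆ B) : leadingMonomials m A ⊆ leadingMonomials m B :=
  fun _ ⟨f, hf, h0⟩ => ⟨f, h hf, h0⟩

theorem initialIdeal_mono {m : MonomialOrder (Fin n)} {I J : Ideal (MvPolynomial (Fin n) ℚ)}
    (h : I ≤ J) : initialIdeal m I ≤ initialIdeal m J :=
  Ideal.span_mono (leadingMonomials_mono h)

theorem exists_degree_eq_of_mono_mem_initialIdeal {m : MonomialOrder (Fin n)}
    {I : Ideal (MvPolynomial (Fin n) ℚ)} {α : Fin n →₀ ℕ} (h : mono α ∈ initialIdeal m I) :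
    ∃ f ∈ I, f ≠ 0 ∧ m.degree f = α := by
  obtain ⟨f, hf, h0, hle⟩ := mono_mem_span_leadingMonomials.1 h
  have hm : mono (α - m.degree f) ≠ 0 := by simp [mono]
  refine ⟨mono (α - m.degree f) * f, I.mul_mem_left _ hf, mul_ne_zero hm h0, ?_⟩
  rw [m.degree_mul hm h0, mono, m.degree_monomial, if_neg one_ne_zero, tsub_add_cancel_of_le hle]

theorem mono_injective : Function.Injective (mono (n := n)) :=
  monomial_left_injective one_ne_zero

end Initial

/-! ### Points, and the lower bound for standard monomials -/

section Points

variable {n s : ℕ}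

/-- The point of `ℚ ^ n` with coordinates given by the letters of `f`. -/
def point (f : Fin n → Fin s) (i : Fin n) : ℚ := (f i : ℕ)

/-- Evaluation at the points given by the members of a set of words. -/
noncomputable def evalPoints (F : Set (Fin n → Fin s)) :
    MvPolynomial (Fin n) ℚ →ₐ[ℚ] (F → ℚ) :=
  AlgHom.ofLinearMap (LinearMap.pi fun f => (aeval (point f.1)).toLinearMap)
    (by ext; simp) (fun p q => by ext; simp)

theorem evalPoints_apply (F : Set (Fin n → Fin s)) (p : MvPolynomial (Fin n) ℚ) (f : F) :
    evalPoints F p f = aeval (point f.1) p := rfl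

theorem natCast_sub_eq_zero_iff {a b : Fin s} : ((a : ℕ) : ℚ) - ((b : ℕ) : ℚ) = 0 ↔ a = b := by
  rw [sub_eq_zero, Nat.cast_inj, Fin.val_inj]

/-- Lagrange interpolation: the product `q` vanishes at every word other than `f`. -/
theorem evalPoints_surjective (F : Set (Fin n → Fin s)) : Function.Surjective (evalPoints F) := by
  classical
  have key : ∀ f : F, ∃ p, evalPoints F p = Pi.single f (1 : ℚ) := by
    intro f
    set q : MvPolynomial (Fin n) ℚ :=
      ∏ i, ∏ j ∈ Finset.univ.erase (f.1 i), (X i - C ((j : ℕ) : ℚ)) with hq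
    have he : ∀ g : F, evalPoints F q g =
        ∏ i, ∏ j ∈ Finset.univ.erase (f.1 i), (((g.1 i : ℕ) : ℚ) - ((j : ℕ) : ℚ)) := by
      intro g
      simp [evalPoints_apply, hq, map_prod, point]
    refine ⟨C (evalPoints F q f)⁻¹ * q, funext fun g => ?_⟩
    rw [map_mul, Pi.mul_apply, evalPoints_apply, aeval_C]
    by_cases hg : g = f
    · subst hg
      rw [Pi.single_eq_same]
      refine inv_mul_cancel₀ ?_
      rw [he]
      refine Finset.prod_ne_zero_iff.2 fun i _ => Finset.prod_ne_zero_iff.2 fun j hj => ?_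
      rw [Ne, natCast_sub_eq_zero_iff]
      exact (Finset.ne_of_mem_erase hj).symm
    · rw [Pi.single_eq_of_ne hg]
      obtain ⟨i, hi⟩ : ∃ i, g.1 i ≠ f.1 i := by
        by_contra! h
        exact hg (Subtype.ext (funext h))
      have h0 : evalPoints F q g = 0 := by
        rw [he]
        refine Finset.prod_eq_zero (Finset.mem_univ i) ?_
        exact Finset.prod_eq_zero (Finset.mem_erase.2 ⟨hi, Finset.mem_univ (g.1 i)⟩) (sub_self _)
      rw [h0, mul_zero]
  choose p hp using key
  have : Fintype F := Fintype.ofFinite F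
  intro v
  refine ⟨∑ f, v f • p f, ?_⟩
  simp only [map_sum, map_smul, hp]
  ext g
  simp [Finset.sum_apply, Pi.single_apply]

/-- If all members of `I` lift to the ideal of a set of words, then `I` has at least as many
standard monomials as there are words. -/
theorem ncard_le_ncard_standard (F : Set (Fin n → Fin s))
    {I : Ideal (MvPolynomial (Fin n) ℚ)}
    (hI : ∀ f ∈ I, TopLiftable (RingHom.ker (evalPoints F)) f)
    (hfin : {α : Fin n →₀ ℕ | mono α ∉ initialIdeal (grevlex n) I}.Finite) :
    F.ncard ≤ {α : Fin n →₀ ℕ | mono α ∉ initialIdeal (grevlex n) I}.ncard := by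
  set B := {α : Fin n →₀ ℕ | mono α ∉ initialIdeal (grevlex n) I} with hB
  set W := Submodule.span ℚ ((fun α => evalPoints F (mono α)) '' B) with hW
  -- Induction along the order: a nonstandard monomial leads some polynomial vanishing on the
  -- points, so its values are combinations of values of smaller monomials.
  have hmem : ∀ a : (grevlex n).syn, evalPoints F (mono ((grevlex n).toSyn.symm a)) ∈ W := by
    intro a
    induction a using WellFoundedLT.induction with
    | ind a ih =>
      set α := (grevlex n).toSyn.symm a with hα
      by_cases hmα : mono α ∈ initialIdeal (grevlex n) I
      · obtain ⟨f, hf, h0, hdeg⟩ := exists_degree_eq_of_mono_mem_initialIdeal hmα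
        obtain ⟨g, hg, hne, hle⟩ := (hI f hf).exists_mem_le h0
        rw [hdeg] at hne hle
        have hsum : g = coeff α g • mono α +
            ∑ m ∈ g.support.erase α, coeff m g • mono m := by
          conv_lhs => rw [g.as_sum, ← Finset.add_sum_erase _ _ (mem_support_iff.2 hne)]
          simp [mono, smul_monomial]
        have h1 := congrArg (evalPoints F) hsum
        rw [(RingHom.mem_ker).1 hg, map_add, map_smul, map_sum] at h1
        have h2 : evalPoints F (mono α) = -((coeff α g)⁻¹ •
            ∑ m ∈ g.support.erase α, evalPoints F (coeff m g • mono m)) := by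
          rw [← neg_eq_of_add_eq_zero_right h1.symm, smul_neg, neg_neg, smul_smul,
            inv_mul_cancel₀ hne, one_smul]
        rw [h2]
        refine W.neg_mem (W.smul_mem _ (W.sum_mem fun m hm => ?_))
        rw [map_smul]
        refine W.smul_mem _ ?_
        rw [Finset.mem_erase, mem_support_iff] at hm
        have hlt : (grevlex n).toSyn m < a := by
          refine lt_of_le_of_ne ?_ fun h => hm.1 (by rw [hα, ← h, AddEquiv.symm_apply_apply])
          have := hle m hm.2
          rwa [hα, AddEquiv.apply_symm_apply] at this
        have := ih _ hlt
        rwa [AddEquiv.symm_apply_apply] at this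
      · exact Submodule.subset_span ⟨α, hmα, rfl⟩
  have htop : W = ⊤ := by
    rw [eq_top_iff]
    intro v _
    obtain ⟨p, rfl⟩ := evalPoints_surjective F v
    rw [p.as_sum, map_sum]
    refine W.sum_mem fun m _ => ?_
    have : monomial m (coeff m p) = coeff m p • mono m := by simp [mono, smul_monomial]
    rw [this, map_smul]
    refine W.smul_mem _ ?_
    have := hmem ((grevlex n).toSyn m)
    rwa [AddEquiv.symm_apply_apply] at this
  have : Fintype F := Fintype.ofFinite F
  have hrank : Module.finrank ℚ W = F.ncard := by
    rw [htop, finrank_top, Module.finrank_fintype_fun_eq_card, ← Nat.card_coe_set_eq,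
      Nat.card_eq_fintype_card]
  rw [← hrank, hW]
  have hfi := (hfin.image fun α => evalPoints F (mono α))
  have : Fintype ((fun α => evalPoints F (mono α)) '' B) := hfi.fintype
  refine (finrank_span_le_card _).trans ?_
  rw [← Set.ncard_eq_toFinset_card']
  exact Set.ncard_image_le hfin

end Points


/-! ### The generators lift -/

theorem elem_isHomogeneous {n : ℕ} (d : ℕ) (S : Finset (Fin n)) : (elem d S).IsHomogeneous d := by
  refine IsHomogeneous.sum _ _ _ fun t ht => ?_
  have := IsHomogeneous.prod t (fun i => (X i : MvPolynomial (Fin n) ℚ)) (fun _ => 1)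
    fun i _ => isHomogeneous_X _ i
  rwa [Finset.sum_const, smul_eq_mul, mul_one, (Finset.mem_powersetCard.1 ht).2] at this

theorem aeval_elem {n : ℕ} (x : Fin n → ℚ) (d : ℕ) (S : Finset (Fin n)) :
    aeval x (elem d S) =
      (∏ i ∈ S, (1 + Polynomial.C (x i) * Polynomial.X) : Polynomial ℚ).coeff d := by
  rw [Finset.prod_one_add, Polynomial.finsetSum_coeff, elem, map_sum,
    Finset.powersetCard_eq_filter, Finset.sum_filter]
  refine Finset.sum_congr rfl fun t _ => ?_
  rw [Finset.prod_mul_distrib, Finset.prod_const, ← map_prod, Polynomial.coeff_C_mul_X_pow,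
    map_prod]
  simp [eq_comm]

theorem prod_eq_prod_pow_card {n s : ℕ} (S : Finset (Fin n)) (f : Fin n → Fin s)
    (u : Fin s → Polynomial ℚ) :
    ∏ i ∈ S, u (f i) = ∏ j, u j ^ (S.filter fun i => f i = j).card := by
  rw [← Finset.prod_fiberwise_of_maps_to (g := f) (t := Finset.univ)
    fun i _ => Finset.mem_univ _]
  refine Finset.prod_congr rfl fun j _ => Finset.prod_eq_pow_card fun i hi => ?_
  rw [(Finset.mem_filter.1 hi).2]

/-- Only `n - S.card` positions lie outside `S`, so a fibre loses at most that many. -/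
theorem sub_le_card_filter {n s : ℕ} {μ : Fin s → ℕ} {f : Fin n → Fin s}
    (hf : f ∈ largeFibers n μ) (S : Finset (Fin n)) (j : Fin s) :
    μ j - (n - S.card) ≤ (S.filter fun i => f i = j).card := by
  have h1 := hf j
  have h2 : (Finset.univ.filter fun i => f i = j).card ≤
      (S.filter fun i => f i = j).card + Sᶜ.card := by
    refine (Finset.card_le_card fun i hi => ?_).trans (Finset.card_union_le _ _)
    by_cases hS : i ∈ S <;> simp_all
  rw [Finset.card_compl, Fintype.card_fin] at h2
  omega

/-- At each point, $\prod_{i\in S}(1+x_it)$ is divisible by one fixed polynomial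
$P(t)=\prod_j(1+jt)^{\mu_j-(n-|S|)}$ (truncated exponents), and the quotient has degree less than
`d`. The coefficient of $t^d$ in the quotient is $\sum_{i\le d}b_i\,e_i(S)$ with
$b_i=[t^{d-i}]P^{-1}$, so this polynomial vanishes on all the points. -/
theorem topLiftable_elem {n s : ℕ} (μ : Fin s → ℕ) {S : Finset (Fin n)} {d : ℕ}
    (hd : (S.card : ℤ) - ((∑ j, (μ j - (n - S.card)) : ℕ) : ℤ) < d) :
    TopLiftable (RingHom.ker (evalPoints (largeFibers n μ))) (elem d S) := by
  set u : Fin s → Polynomial ℚ := fun j => 1 + Polynomial.C ((j : ℕ) : ℚ) * Polynomial.X with hu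
  set P : Polynomial ℚ := ∏ j, u j ^ (μ j - (n - S.card)) with hP
  have hP1 : PowerSeries.constantCoeff (P : PowerSeries ℚ) = 1 := by
    rw [← PowerSeries.coeff_zero_eq_constantCoeff_apply, Polynomial.coeff_coe,
      Polynomial.coeff_zero_eq_eval_zero, hP, Polynomial.eval_prod]
    simp [hu]
  -- `P` has constant term 1, so it is invertible as a power series and the coefficient of `elem d
  -- S` is 1.
  refine topLiftable_of_sum_mem (H := fun i => elem i S)
    (b := fun i => PowerSeries.coeff (d - i) (P : PowerSeries ℚ)⁻¹)
    (fun i => elem_isHomogeneous i S) (by simp [hP1]) ?_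
  rw [RingHom.mem_ker]
  funext f
  obtain ⟨f, hf⟩ := f
  set c : Fin s → ℕ := fun j => (S.filter fun i => f i = j).card with hc
  set Q : Polynomial ℚ := ∏ j, u j ^ (c j - (μ j - (n - S.card))) with hQ
  have hE : ∏ i ∈ S, (1 + Polynomial.C (point f i) * Polynomial.X) = Q * P := by
    rw [show ∏ i ∈ S, (1 + Polynomial.C (point f i) * Polynomial.X) = ∏ i ∈ S, u (f i) from rfl,
      prod_eq_prod_pow_card, hQ, hP, ← Finset.prod_mul_distrib]
    refine Finset.prod_congr rfl fun j _ => ?_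
    rw [← pow_add, tsub_add_cancel_of_le (sub_le_card_filter hf S j)]
  have hQd : Q.natDegree < d := by
    have h1 : Q.natDegree ≤ ∑ j, (c j - (μ j - (n - S.card))) := by
      refine (Polynomial.natDegree_prod_le _ _).trans (Finset.sum_le_sum fun j _ => ?_)
      refine (Polynomial.natDegree_pow_le).trans ?_
      refine (Nat.mul_le_mul_left _ (?_ : (u j).natDegree ≤ 1)).trans (mul_one _).le
      simp only [hu]
      compute_degree
    have h2 : ∑ j, (c j - (μ j - (n - S.card))) + ∑ j, (μ j - (n - S.card)) = S.card := by
      rw [← Finset.sum_add_distrib]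
      refine Eq.trans ?_ (Finset.card_eq_sum_card_fiberwise (f := f)
        (t := Finset.univ) fun i _ => Finset.mem_univ _).symm
      exact Finset.sum_congr rfl fun j _ => tsub_add_cancel_of_le (sub_le_card_filter hf S j)
    omega
  have hQP : ((Q * P : Polynomial ℚ) : PowerSeries ℚ) * (P : PowerSeries ℚ)⁻¹ = Q := by
    rw [Polynomial.coe_mul, mul_assoc,
      PowerSeries.mul_inv_cancel _ (by rw [hP1]; exact one_ne_zero), mul_one]
  have hcoeff := congrArg (PowerSeries.coeff d) hQP
  rw [Polynomial.coeff_coe, Polynomial.coeff_eq_zero_of_natDegree_lt hQd, PowerSeries.coeff_mul,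
    Finset.Nat.sum_antidiagonal_eq_sum_range_succ fun i j =>
      PowerSeries.coeff i ((Q * P : Polynomial ℚ) : PowerSeries ℚ) *
        PowerSeries.coeff j (P : PowerSeries ℚ)⁻¹] at hcoeff
  rw [evalPoints_apply, Pi.zero_apply, map_sum, ← hcoeff]
  refine Finset.sum_congr rfl fun i _ => ?_
  rw [map_mul, aeval_C, aeval_elem, hE, Polynomial.coeff_coe, mul_comm]
  rfl

/-- The polynomial $\prod_{j<s}(x_i-j)$ vanishes on the points and has top form $x_i^s$. -/
theorem topLiftable_X_pow {n s : ℕ} (F : Set (Fin n → Fin s)) (i : Fin n) :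
    TopLiftable (RingHom.ker (evalPoints F)) (X i ^ s) := by
  set P : Polynomial ℚ := ∏ j : Fin s, (Polynomial.X - Polynomial.C ((j : ℕ) : ℚ)) with hP
  have hdeg : P.natDegree = s := by
    rw [hP, Polynomial.natDegree_finsetProd_X_sub_C_eq_card, Finset.card_univ, Fintype.card_fin]
  have hmonic : P.Monic := Polynomial.monic_prod_X_sub_C _ _
  refine topLiftable_of_sum_mem (H := fun k => X i ^ k) (b := P.coeff)
    (fun k => isHomogeneous_X_pow i k) (by
      have := hmonic.coeff_natDegree
      rwa [hdeg] at this) ?_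
  rw [RingHom.mem_ker]
  funext f
  have : aeval (point f.1) (∑ k ∈ Finset.range (s + 1), C (P.coeff k) * X i ^ k) =
      P.eval (point f.1 i) := by
    rw [Polynomial.eval_eq_sum_range, hdeg]
    simp
  rw [evalPoints_apply, this, hP, Polynomial.eval_prod]
  exact Finset.prod_eq_zero (Finset.mem_univ (f.1 i)) (by simp [point])

/-- Both sides count the boxes of the diagram beyond column `n - m`, by columns and by rows. -/
theorem pSum_eq_sum_rows {n k s : ℕ} {lam : Nat.Partition k} {μ : Fin s → ℕ}
    (hμ : Finset.univ.val.map μ = lam.parts + Multiset.replicate (s - lam.parts.card) 0) (m : ℕ) :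
    pSum n m lam = ∑ j, (μ j - (n - m)) := by
  -- This makes the cut-off at `k` in `pSum` harmless.
  have hle : ∀ j, μ j ≤ k := by
    intro j
    have hj : μ j ∈ lam.parts + Multiset.replicate (s - lam.parts.card) 0 := by
      rw [← hμ]; exact Multiset.mem_map_of_mem _ (Finset.mem_univ_val j)
    rcases Multiset.mem_add.1 hj with h | h
    · exact (Multiset.le_sum_of_mem h).trans lam.parts_sum.le
    · rw [Multiset.eq_of_mem_replicate h]; exact Nat.zero_le _
  have hconj : ∀ i ∈ Finset.Icc (n - m + 1) k, conj lam i = ∑ j, if i ≤ μ j then 1 else 0 := by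
    intro i hi
    obtain ⟨i, rfl⟩ := Nat.exists_eq_succ_of_ne_zero
      (show i ≠ 0 by rw [Finset.mem_Icc] at hi; omega)
    rw [← Finset.card_filter]
    exact (congrFun (colHeight_eq_conj hμ) i).symm
  rw [pSum, Finset.sum_congr rfl hconj, Finset.sum_comm]
  refine Finset.sum_congr rfl fun j _ => ?_
  rw [← Finset.card_filter]
  have : (Finset.Icc (n - m + 1) k).filter (· ≤ μ j) = Finset.Icc (n - m + 1) (μ j) := by
    ext i
    have := hle j
    simp only [Finset.mem_filter, Finset.mem_Icc]
    omega
  rw [this, Nat.card_Icc]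
  omega

theorem topLiftable_of_mem_idealFin {n k s : ℕ} {lam : Nat.Partition k} {μ : Fin s → ℕ}
    (hμ : Finset.univ.val.map μ = lam.parts + Multiset.replicate (s - lam.parts.card) 0)
    {f : MvPolynomial (Fin n) ℚ} (hf : f ∈ idealFin n lam s) :
    TopLiftable (RingHom.ker (evalPoints (largeFibers n μ))) f := by
  refine topLiftable_of_mem_span ?_ hf
  rintro g (⟨S, d, hd, rfl⟩ | ⟨i, rfl⟩)
  · rw [pSum_eq_sum_rows hμ] at hd
    exact topLiftable_elem μ hd
  · exact topLiftable_X_pow _ i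

/-! ### Standard monomials and Gröbner bases -/

theorem idealInf_le_idealFin {n k : ℕ} (lam : Nat.Partition k) (s : ℕ) :
    idealInf n lam ≤ idealFin n lam s :=
  Ideal.span_mono Set.subset_union_left

theorem varPowers_subset_idealFin {n k : ℕ} (lam : Nat.Partition k) (s : ℕ) :
    varPowers n s ⊆ idealFin n lam s :=
  Set.subset_union_right.trans Ideal.subset_span

theorem standardMonomials_eq_image {n : ℕ} (m : MonomialOrder (Fin n))
    (I : Ideal (MvPolynomial (Fin n) ℚ)) :
    standardMonomials m I = mono '' {α | mono α ∉ initialIdeal m I} := by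
  ext p
  constructor
  · rintro ⟨α, rfl, h⟩; exact ⟨α, h, rfl⟩
  · rintro ⟨α, h, rfl⟩; exact ⟨α, rfl, h⟩

theorem monoCompl_image {n : ℕ} (A : Set (Fin n →₀ ℕ)) : monoCompl (mono '' A) = mono '' Aᶜ := by
  ext p
  constructor
  · rintro ⟨α, rfl, h⟩; exact ⟨α, fun hα => h ⟨α, hα, rfl⟩, rfl⟩
  · rintro ⟨α, h, rfl⟩
    exact ⟨α, rfl, fun h' => h (mono_injective.mem_set_image.1 h')⟩

/-- A finite subset of `I` whose leading monomials divide all monomials outside of the set of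
standard monomials is a Gröbner basis. -/
theorem isGroebnerBasis_of_forall {n : ℕ} {m : MonomialOrder (Fin n)}
    {G : Set (MvPolynomial (Fin n) ℚ)} {I : Ideal (MvPolynomial (Fin n) ℚ)} (hfin : G.Finite)
    (hGI : G ⊆ I) (h : ∀ α, mono α ∈ initialIdeal m I →
      mono α ∈ Ideal.span (leadingMonomials m G)) : IsGroebnerBasis m G I := by
  refine ⟨hfin, hGI, le_antisymm (Ideal.span_mono (leadingMonomials_mono hGI)) ?_⟩
  refine Ideal.span_le.2 ?_
  rintro p ⟨f, hf, h0, rfl⟩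
  exact h _ (Ideal.subset_span ⟨f, hf, h0, rfl⟩)

theorem X_pow_degree {n : ℕ} (m : MonomialOrder (Fin n)) (i : Fin n) (s : ℕ) :
    m.degree (X i ^ s : MvPolynomial (Fin n) ℚ) = Finsupp.single i s := by
  classical
  rw [X_pow_eq_monomial, m.degree_monomial, if_neg one_ne_zero]

/-- The monomials outside of `A_{n,λ,s}` are divisible by leading monomials of `G` or by powers of
variables. -/
theorem mono_mem_span_of_notMem_compFin {n k s : ℕ} {lam : Nat.Partition k}
    {G : Set (MvPolynomial (Fin n) ℚ)}
    (hG : ∀ α ∉ compInf n lam, mono α ∈ Ideal.span (leadingMonomials (grevlex n) G))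
    {α : Fin n →₀ ℕ} (hα : α ∉ compFin n lam s) :
    mono α ∈ Ideal.span (leadingMonomials (grevlex n) (G ∪ varPowers n s)) := by
  by_cases h : α ∈ compInf n lam
  · obtain ⟨t, _, _, ht⟩ := h
    obtain ⟨i, hi⟩ : ∃ i, s ≤ α i := by
      by_contra! hlt
      exact hα (mem_compFin_of_forall_lt ht hlt)
    refine mono_mem_span_leadingMonomials.2
      ⟨X i ^ s, Or.inr ⟨i, rfl⟩, pow_ne_zero _ (X_ne_zero i), ?_⟩
    rwa [X_pow_degree, Finsupp.single_le_iff]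
  · exact Ideal.span_mono (leadingMonomials_mono Set.subset_union_left) (hG α h)

/-- The standard exponents lie in the finite set `compFin n lam s`, which has at most as many
elements as there are points, and there are at most as many points as standard exponents; so the
inclusion is an equality. -/
theorem setOf_mono_notMem_initialIdeal_idealFin {n k s : ℕ} {lam : Nat.Partition k}
    {G : Set (MvPolynomial (Fin n) ℚ)} (hGI : G ⊆ idealInf n lam)
    (hG : ∀ α ∉ compInf n lam, mono α ∈ Ideal.span (leadingMonomials (grevlex n) G))
    (hs : 1 ≤ s) (hl : lam.parts.card ≤ s) :
    {α | mono α ∉ initialIdeal (grevlex n) (idealFin n lam s)} = compFin n lam s := by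
  obtain ⟨μ, hμ⟩ := exists_rows lam hl
  have hsub : {α | mono α ∉ initialIdeal (grevlex n) (idealFin n lam s)} ⊆ compFin n lam s := by
    intro α hα
    by_contra h
    refine hα (Ideal.span_mono (leadingMonomials_mono ?_) (mono_mem_span_of_notMem_compFin hG h))
    exact Set.union_subset (hGI.trans (idealInf_le_idealFin lam s))
      (varPowers_subset_idealFin lam s)
  have hfin := finite_compFin (n := n) hs hl
  exact Set.eq_of_subset_of_ncard_le hsub ((ncard_compFin_le hs hμ).trans
    (ncard_le_ncard_standard _ (fun f hf => topLiftable_of_mem_idealFin hμ hf)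
      (hfin.subset hsub))) hfin

/-- No count is needed here: an exponent in some `compFin n lam s` is standard for the larger ideal
`idealFin n lam s`, hence for `idealInf n lam`. -/
theorem setOf_mono_notMem_initialIdeal_idealInf {n k : ℕ} {lam : Nat.Partition k}
    {G : Set (MvPolynomial (Fin n) ℚ)} (hGI : G ⊆ idealInf n lam)
    (hG : ∀ α ∉ compInf n lam, mono α ∈ Ideal.span (leadingMonomials (grevlex n) G)) :
    {α | mono α ∉ initialIdeal (grevlex n) (idealInf n lam)} = compInf n lam := by
  refine Set.Subset.antisymm (fun α hα => ?_) ?_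
  · by_contra h
    exact hα (Ideal.span_mono (leadingMonomials_mono hGI) (hG α h))
  · rintro α ⟨s, hs, hl, hα⟩ hmem
    rw [← setOf_mono_notMem_initialIdeal_idealFin hGI hG hs hl] at hα
    exact hα (initialIdeal_mono (idealInf_le_idealFin lam s) hmem)

end Griffin

theorem lemmaL (n k : ℕ) (lam : Nat.Partition k) (hk : k ≤ n)
    (G : Set (MvPolynomial (Fin n) ℚ)) (hfin : G.Finite)
    (hGI : G ⊆ (Griffin.idealInf n lam : Set (MvPolynomial (Fin n) ℚ)))
    (hG : Ideal.span (Griffin.leadingMonomials (Griffin.grevlex n) G) =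
      Ideal.span (Griffin.monoCompl (Griffin.monoInf n lam))) :
    (Griffin.IsGroebnerBasis (Griffin.grevlex n) G (Griffin.idealInf n lam) ∧
      Griffin.standardMonomials (Griffin.grevlex n) (Griffin.idealInf n lam) =
        Griffin.monoInf n lam) ∧
    ∀ s : ℕ, 1 ≤ s → lam.parts.card ≤ s →
      Griffin.IsGroebnerBasis (Griffin.grevlex n) (G ∪ Griffin.varPowers n s)
        (Griffin.idealFin n lam s) ∧
      Griffin.standardMonomials (Griffin.grevlex n) (Griffin.idealFin n lam s) =
        Griffin.monoFin n lam s := by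
  have hG' : ∀ α ∉ Griffin.compInf n lam, Griffin.mono α ∈
      Ideal.span (Griffin.leadingMonomials (Griffin.grevlex n) G) := by
    intro α hα
    rw [hG, Griffin.monoInf, Griffin.monoCompl_image]
    exact Ideal.subset_span ⟨α, hα, rfl⟩
  refine ⟨⟨Griffin.isGroebnerBasis_of_forall hfin hGI fun α hα => hG' α fun h => ?_, ?_⟩,
    fun s hs hl => ⟨Griffin.isGroebnerBasis_of_forall (hfin.union (Set.finite_range _))
      (Set.union_subset (hGI.trans (Griffin.idealInf_le_idealFin lam s))
        (Griffin.varPowers_subset_idealFin lam s)) fun α hα =>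
      Griffin.mono_mem_span_of_notMem_compFin hG' fun h => ?_, ?_⟩⟩
  · rw [← Griffin.setOf_mono_notMem_initialIdeal_idealInf hGI hG'] at h
    exact h hα
  · rw [Griffin.standardMonomials_eq_image,
      Griffin.setOf_mono_notMem_initialIdeal_idealInf hGI hG', Griffin.monoInf]
  · rw [← Griffin.setOf_mono_notMem_initialIdeal_idealFin hGI hG' hs hl] at h
    exact h hα
  · rw [Griffin.standardMonomials_eq_image,
      Griffin.setOf_mono_notMem_initialIdeal_idealFin hGI hG' hs hl, Griffin.monoFin]
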